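/- A graph is a set (possibly empty) with an arbitrary binary relation, and a morphism of graphs is a function which preserves the relation. For a set $S$ let $\mathbb{Z}[S]$ denote the free abelian group with basis $S$. There exists a functor $G$ from the category $\mathcal{G}raphs$ of all graphs to the category of abelian groups, with $GX$ torsion free for every graph $X$, such that for all graphs $X$ and $Y$ the homomorphism $$\gamma_{X,Y}:\mathbb{Z}[\mathrm{Hom}_{\mathcal{G}raphs}(X,Y)]\longrightarrow \mathrm{Hom}(GX,GY),\qquad \sum_i k_i\varphi_i\longmapsto \sum_i k_i\,G\varphi_i,$$ is an isomorphism of abelian groups. This isomorphism is natural in $X$ and $Y$: for all morphisms of graphs $f:X'\to X$ and $g:Y\to Y'$ and all $a\in\mathbb{Z}[\mathrm{Hom}_{\mathcal{G}raphs}(X,Y)]$ we have $\gamma_{X',Y'}(g\,a\,f)=Gg\circ\gamma_{X,Y}(a)\circ Gf$, where $a\mapsto g\,a\,f$ is the additive extension of $\varphi\mapsto g\circ\varphi\circ f$. -/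

import Mathlib

open CategoryTheory

universe u

/-- A graph: a set of vertices (possibly empty) together with an arbitrary binary relation on it
(loops are allowed, no symmetry is required). -/
structure RelGraph : Type (u + 1) where
  /-- the set of vertices -/
  Vertex : Type u
  /-- the edge relation -/
  Edge : Vertex → Vertex → Prop

/-- The category of graphs: morphisms are the functions between the sets of vertices which
preserve the relation. -/
instance RelGraph.category : Category.{u} RelGraph.{u} where
  Hom X Y := X.Edge →r Y.Edge
  id X := RelHom.id X.Edge
  comp f g := RelHom.comp g f

/-! Let C, D range over the graphs on sets of natural numbers. In the free module over the dyadic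
integers on all pairs (C, h : C → X), the group GX is the 2-pure hull of the group generated by the
basis and by the vectors `v (a, false)` · h + `v (a, true)` · (h ∘ a) for a : C → D and h : D → X.
The numbers `v` are algebraically independent dyadic integers; there are at most continuum many a,
so enough of them exist.

Purity forces every homomorphism GX → GY to respect the dyadic coefficients (`map_arr`). Up to a
power of 2, coordinates in GY are values at `v` of integral polynomials of degree at most one.
Comparing coefficients (`exists_eq_mapDomain`), h goes to an integral combination of morphisms D →
Y, and h ∘ a to the same combination composed with a. A homomorphism is thus a natural family Hom(C,
X) → ℤ[Hom(C, Y)].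

Such a family comes from one finite combination of morphisms X → Y (`exists_eq_mapDomain_comp`). It
gives an element of ℤ[Hom(T, Y)] for each countable set T of vertices; the size of its support grows
with T but is bounded, and beyond a maximal T₀ the supports correspond bijectively, so their members
glue to morphisms on X. Injectivity holds because finitely many morphisms are separated by countably
many vertices. -/

/-! ### Cardinalities and algebraically independent dyadic integers -/

open Cardinal in
theorem continuum_le_mk_padicInt : 𝔠 ≤ #ℤ_[2] := by
  have h := continuum_le_cardinal_of_nontriviallyNormedField ℚ_[2]
  rwa [IsFractionRing.cardinalMk ℤ_[2] ℚ_[2]] at h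

open Cardinal in
/-- There are continuum many algebraically independent dyadic integers. -/
theorem exists_algebraicIndependent_padicInt (I : Type) (hI : #I ≤ 𝔠) :
    ∃ v : I → ℤ_[2], AlgebraicIndependent ℤ v := by
  obtain ⟨S, hS⟩ := exists_isTranscendenceBasis ℤ ℤ_[2]
  have hc : 𝔠 ≤ #S := by
    -- A smaller basis would generate a ring of size less than 𝔠, over which the dyadic integers are
    -- algebraic.
    by_contra! hlt
    have := hS.isAlgebraic
    have h1 := Algebra.IsAlgebraic.cardinalMk_le_max
      (Algebra.adjoin ℤ (Set.range (Subtype.val : S → ℤ_[2]))) ℤ_[2]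
    have h2 := Algebra.lift_cardinalMk_adjoin_le ℤ (Set.range (Subtype.val : S → ℤ_[2]))
    simp only [lift_id, Subtype.range_coe_subtype, Set.ofPred_mem_eq, mk_int] at h1 h2
    have h3 := continuum_le_mk_padicInt.trans h1
    have h4 : max (max ℵ₀ #S) ℵ₀ < 𝔠 :=
      max_lt (max_lt aleph0_lt_continuum hlt) aleph0_lt_continuum
    exact absurd h3 (not_le.2 (max_lt (h2.trans_lt h4) aleph0_lt_continuum))
  obtain ⟨f⟩ := (Cardinal.le_def _ _).1 (hI.trans hc)
  exact ⟨fun i => (f i : ℤ_[2]), hS.1.comp f f.injective⟩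

/-- A graph whose set of vertices is a set of natural numbers. -/
abbrev NatGraph : Type := Σ S : Set ℕ, S → S → Prop

/-- The morphisms between graphs on sets of natural numbers. -/
abbrev NatGraph.Arrow : Type := Σ P : NatGraph × NatGraph, P.1.2 →r P.2.2

open Cardinal in
theorem NatGraph.mk_le : #NatGraph ≤ 𝔠 := by
  rw [mk_sigma]
  refine (sum_le_mk_mul_iSup _).trans ?_
  refine (mul_le_mul' (by simp) (ciSup_le' fun S => ?_)).trans (continuum_mul_self).le
  have : #(S → S → Prop) = 2 ^ (#S * #S) := by
    simp [Cardinal.power_mul]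
  rw [this, ← two_power_aleph0]
  exact power_le_power_left two_ne_zero
    ((mul_le_mul' mk_le_aleph0 mk_le_aleph0).trans aleph0_mul_aleph0.le)

open Cardinal in
theorem NatGraph.mk_arrow_prod_bool_le : #(NatGraph.Arrow × Bool) ≤ 𝔠 := by
  have h : #NatGraph.Arrow ≤ 𝔠 := by
    rw [mk_sigma]
    refine (sum_le_mk_mul_iSup _).trans ?_
    refine (mul_le_mul' ?_ (ciSup_le' fun P => ?_)).trans (continuum_mul_self).le
    · simpa using mul_le_mul' mk_le mk_le
    · refine (mk_le_of_injective (f := fun g : P.1.2 →r P.2.2 => (g : P.1.1 → P.2.1))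
        DFunLike.coe_injective).trans ?_
      rw [← Cardinal.power_def]
      refine (power_le_power_right (mk_le_aleph0.trans aleph0_le_continuum)).trans ?_
      exact (power_le_power_left continuum_ne_zero mk_le_aleph0).trans continuum_power_aleph0.le
  rw [mk_prod, lift_id, lift_id, mk_bool]
  exact (mul_le_mul' h (nat_lt_continuum 2).le).trans continuum_mul_self.le

/-! ### Pure subgroups attached to labelled quivers -/

/-- A quiver with labelled arrows, in which an arrow is determined by its label and target. -/
structure LabelledQuiver (A : Type) where
  /-- the set of vertices -/
  Vert : Type u
  /-- the set of arrows -/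
  Arr : Type u
  /-- the label of an arrow -/
  lab : Arr → A
  /-- the source of an arrow -/
  src : Arr → Vert
  /-- the target of an arrow -/
  tgt : Arr → Vert
  tgt_injOn : ∀ e e', lab e = lab e' → tgt e = tgt e' → e = e'

namespace LabelledQuiver

variable {A : Type} (v : A × Bool → ℤ_[2]) (Q Q' : LabelledQuiver.{u} A)

/-- The vector attached to an arrow. -/
noncomputable def arrVec (e : Q.Arr) : Q.Vert →₀ ℤ_[2] :=
  Finsupp.single (Q.tgt e) (v (Q.lab e, false)) + Finsupp.single (Q.src e) (v (Q.lab e, true))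

/-- The group generated by the vertices and by the vectors of the arrows. -/
noncomputable def gen : AddSubgroup (Q.Vert →₀ ℤ_[2]) :=
  AddSubgroup.closure (Set.range (fun b => Finsupp.single b 1) ∪ Set.range (Q.arrVec v))

/-- The `2`-pure hull of `gen`. -/
noncomputable def hull : AddSubgroup (Q.Vert →₀ ℤ_[2]) where
  carrier := {x | ∃ k : ℕ, (2 ^ k : ℤ) • x ∈ Q.gen v}
  zero_mem' := ⟨0, by simp⟩
  add_mem' := by
    rintro x y ⟨k, hk⟩ ⟨l, hl⟩
    refine ⟨k + l, ?_⟩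
    have h1 := AddSubgroup.zsmul_mem _ hk (2 ^ l)
    have h2 := AddSubgroup.zsmul_mem _ hl (2 ^ k)
    rw [smul_smul] at h1 h2
    rw [smul_add, pow_add]
    refine AddSubgroup.add_mem _ ?_ h2
    rwa [mul_comm]
  neg_mem' := by
    rintro x ⟨k, hk⟩
    exact ⟨k, by rw [smul_neg]; exact AddSubgroup.neg_mem _ hk⟩

variable {v Q Q'}

theorem gen_le_hull : Q.gen v ≤ Q.hull v := fun x hx => ⟨0, by simpa using hx⟩

theorem single_mem_hull (b : Q.Vert) : Finsupp.single b 1 ∈ Q.hull v :=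
  gen_le_hull (AddSubgroup.subset_closure (Or.inl ⟨b, rfl⟩))

theorem arrVec_mem_hull (e : Q.Arr) : Q.arrVec v e ∈ Q.hull v :=
  gen_le_hull (AddSubgroup.subset_closure (Or.inr ⟨e, rfl⟩))

theorem mem_hull_of_pow_smul_mem {x : Q.Vert →₀ ℤ_[2]} (n : ℕ)
    (h : (2 ^ n : ℤ) • x ∈ Q.hull v) : x ∈ Q.hull v := by
  obtain ⟨k, hk⟩ := h
  exact ⟨k + n, by rwa [pow_add, ← smul_smul]⟩

/-- A vertex as an element of the pure hull. -/
noncomputable def vert (v : A × Bool → ℤ_[2]) (b : Q.Vert) : Q.hull v :=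
  ⟨Finsupp.single b 1, single_mem_hull b⟩

/-- An arrow as an element of the pure hull. -/
noncomputable def arr (v : A × Bool → ℤ_[2]) (e : Q.Arr) : Q.hull v :=
  ⟨Q.arrVec v e, arrVec_mem_hull e⟩

theorem exists_int_approx (x : ℤ_[2]) (n : ℕ) : ∃ (m : ℤ) (y : ℤ_[2]), x = m + 2 ^ n * y := by
  obtain ⟨y, hy⟩ := Ideal.mem_span_singleton.1 (PadicInt.appr_spec n x)
  refine ⟨(x.appr n : ℕ), y, ?_⟩
  push_cast at hy ⊢
  rw [← hy]
  ring

theorem eq_zero_of_forall_pow_dvd {x : ℤ_[2]} (h : ∀ n : ℕ, (2 : ℤ_[2]) ^ n ∣ x) : x = 0 := by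
  by_contra hx
  have hf : FiniteMultiplicity (2 : ℤ_[2]) x :=
    FiniteMultiplicity.of_not_isUnit (by simpa using (PadicInt.prime_p (p := 2)).not_isUnit) hx
  obtain ⟨n, hn⟩ := hf
  exact hn (h _)

/-- Homomorphisms between pure hulls are automatically linear over the dyadic integers. -/
theorem map_arr (φ : Q.hull v →+ Q'.hull v) (e : Q.Arr) (b : Q'.Vert) :
    (φ (arr v e)).1 b = v (Q.lab e, false) * (φ (vert v (Q.tgt e))).1 b +
      v (Q.lab e, true) * (φ (vert v (Q.src e))).1 b := by
  rw [← sub_eq_zero]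
  refine eq_zero_of_forall_pow_dvd fun n => ?_
  obtain ⟨m, y, hy⟩ := exists_int_approx (v (Q.lab e, false)) n
  obtain ⟨m', y', hy'⟩ := exists_int_approx (v (Q.lab e, true)) n
  -- Up to an integral combination of vertices, the arrow is 2 ^ n times an element of the hull, by
  -- purity; hence the two sides agree modulo 2 ^ n.
  have key : (2 ^ n : ℤ) • (Finsupp.single (Q.tgt e) y + Finsupp.single (Q.src e) y') =
      (arr v e - m • vert v (Q.tgt e) - m' • vert v (Q.src e) : Q.hull v).1 := by
    simp only [arr, vert, arrVec, hy, hy', AddSubgroup.coe_sub, AddSubgroup.coe_zsmul,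
      Finsupp.smul_single, smul_add, Finsupp.single_add, zsmul_eq_mul, mul_one]
    push_cast
    abel
  let z : Q.hull v := ⟨Finsupp.single (Q.tgt e) y + Finsupp.single (Q.src e) y',
    mem_hull_of_pow_smul_mem n (by rw [key]; exact Subtype.property _)⟩
  have hz : (2 ^ n : ℤ) • z = arr v e - m • vert v (Q.tgt e) - m' • vert v (Q.src e) :=
    Subtype.ext key
  have h2 := congrArg (fun w : Q'.hull v => w.1 b) (congrArg φ hz)
  simp only [map_sub, map_zsmul, AddSubgroup.coe_sub, AddSubgroup.coe_zsmul, Finsupp.sub_apply,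
    Finsupp.smul_apply, zsmul_eq_mul] at h2
  push_cast at h2
  refine ⟨(φ z).1 b - y * (φ (vert v (Q.tgt e))).1 b - y' * (φ (vert v (Q.src e))).1 b, ?_⟩
  rw [hy, hy', mul_sub, mul_sub, h2]
  ring

/-- By `map_arr` the values on vertices determine those on arrows, and powers of 2 cancel in the
target. -/
theorem hom_ext {φ ψ : Q.hull v →+ Q'.hull v} (h : ∀ b, φ (vert v b) = ψ (vert v b)) :
    φ = ψ := by
  have hgen : ∀ x (hx : x ∈ Q.gen v), φ ⟨x, gen_le_hull hx⟩ = ψ ⟨x, gen_le_hull hx⟩ := by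
    intro x hx
    induction hx using AddSubgroup.closure_induction with
    | mem x hx =>
      rcases hx with ⟨b, rfl⟩ | ⟨e, rfl⟩
      · exact h b
      · refine Subtype.ext (Finsupp.ext fun b => ?_)
        exact (map_arr φ e b).trans (by rw [h, h]; exact (map_arr ψ e b).symm)
    | zero => exact (map_zero φ).trans (map_zero ψ).symm
    | add x y hx hy h1 h2 =>
      have := congrArg₂ (· + ·) h1 h2
      simp only [← map_add] at this
      exact this
    | neg x hx h1 =>
      have := congrArg (- ·) h1
      simp only [← map_neg] at this
      exact this
  ext1 ⟨x, k, hk⟩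
  have h1 := hgen _ hk
  have h2 : (⟨(2 ^ k : ℤ) • x, gen_le_hull hk⟩ : Q.hull v) = (2 ^ k : ℤ) • ⟨x, k, hk⟩ := rfl
  rw [h2, map_zsmul, map_zsmul] at h1
  refine Subtype.ext (Finsupp.ext fun b => ?_)
  have h3 := congrArg (fun w : Q'.hull v => w.1 b) h1
  simp only [AddSubgroup.coe_zsmul, Finsupp.smul_apply, zsmul_eq_mul] at h3
  push_cast at h3
  exact mul_left_cancel₀ (pow_ne_zero k two_ne_zero) h3

/-! ### Coordinates as polynomials of degree at most one -/

open Classical in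
/-- The polynomials of degree at most one giving the coordinates of the elements of `gen`. -/
noncomputable def linPoly (c₀ : Q.Vert →₀ ℤ) (c : Q.Arr →₀ ℤ) (b : Q.Vert) :
    MvPolynomial (A × Bool) ℤ :=
  MvPolynomial.C (c₀ b) + c.sum fun e n =>
    n • ((if Q.tgt e = b then MvPolynomial.X (Q.lab e, false) else 0) +
      (if Q.src e = b then MvPolynomial.X (Q.lab e, true) else 0))

theorem linPoly_add (c₀ d₀ : Q.Vert →₀ ℤ) (c d : Q.Arr →₀ ℤ) (b : Q.Vert) :
    linPoly (c₀ + d₀) (c + d) b = linPoly c₀ c b + linPoly d₀ d b := by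
  classical
  rw [linPoly, linPoly, linPoly, Finsupp.sum_add_index' (by simp) (by intros; rw [add_smul]),
    Finsupp.add_apply, map_add]
  abel

theorem linPoly_zero (b : Q.Vert) : linPoly (0 : Q.Vert →₀ ℤ) 0 b = 0 := by
  simp [linPoly]

theorem linPoly_neg (c₀ : Q.Vert →₀ ℤ) (c : Q.Arr →₀ ℤ) (b : Q.Vert) :
    linPoly (-c₀) (-c) b = -linPoly c₀ c b := by
  rw [eq_neg_iff_add_eq_zero, ← linPoly_add, neg_add_cancel, neg_add_cancel, linPoly_zero]

theorem exists_linPoly {x : Q.Vert →₀ ℤ_[2]} (hx : x ∈ Q.gen v) :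
    ∃ c₀ c, ∀ b, x b = MvPolynomial.aeval v (linPoly c₀ c b) := by
  classical
  induction hx using AddSubgroup.closure_induction with
  | mem x hx =>
    rcases hx with ⟨b, rfl⟩ | ⟨e, rfl⟩
    · refine ⟨Finsupp.single b 1, 0, fun b' => ?_⟩
      by_cases h : b = b' <;> simp [linPoly, h]
    · refine ⟨0, Finsupp.single e 1, fun b' => ?_⟩
      by_cases h : Q.tgt e = b' <;> by_cases h' : Q.src e = b' <;>
        simp [linPoly, arrVec, h, h']
  | zero => exact ⟨0, 0, by simp [linPoly_zero]⟩
  | add x y _ _ h1 h2 =>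
    obtain ⟨c₀, c, h1⟩ := h1
    obtain ⟨d₀, d, h2⟩ := h2
    exact ⟨c₀ + d₀, c + d, fun b => by rw [linPoly_add, map_add, Finsupp.add_apply, h1, h2]⟩
  | neg x _ h1 =>
    obtain ⟨c₀, c, h1⟩ := h1
    exact ⟨-c₀, -c, fun b => by rw [linPoly_neg, map_neg, Finsupp.neg_apply, h1]⟩

/-- The exponent may be any large one, so that several elements can share a denominator. -/
theorem exists_linPoly_hull (x : Q.hull v) :
    ∃ N, ∀ n, N ≤ n → ∃ c₀ c, ∀ b, 2 ^ n * x.1 b = MvPolynomial.aeval v (linPoly c₀ c b) := by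
  obtain ⟨x, k, hk⟩ := x
  refine ⟨k, fun n hn => ?_⟩
  obtain ⟨m, rfl⟩ := Nat.exists_eq_add_of_le hn
  have h : (2 ^ (k + m) : ℤ) • x ∈ Q.gen v := by
    have := AddSubgroup.zsmul_mem _ hk (2 ^ m)
    rwa [smul_smul, ← pow_add, add_comm] at this
  obtain ⟨c₀, c, hc⟩ := exists_linPoly h
  refine ⟨c₀, c, fun b => ?_⟩
  rw [← hc, Finsupp.smul_apply, zsmul_eq_mul]
  push_cast
  rfl

open Classical in
theorem coeff_linPoly_false (c₀ : Q.Vert →₀ ℤ) (c : Q.Arr →₀ ℤ) (b : Q.Vert) (a : A) :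
    (linPoly c₀ c b).coeff (Finsupp.single (a, false) 1) =
      (c.filter (fun e => Q.lab e = a)).mapDomain Q.tgt b := by
  have h0 : (0 : A × Bool →₀ ℕ) ≠ Finsupp.single (a, false) 1 :=
    (Finsupp.single_ne_zero.2 one_ne_zero).symm
  rw [linPoly, MvPolynomial.coeff_add, MvPolynomial.coeff_C, if_neg h0, zero_add]
  induction c using Finsupp.induction_linear with
  | zero => simp [Finsupp.filter_zero]
  | add f g hf hg =>
    rw [Finsupp.sum_add_index' (by simp) (by intros; rw [add_smul]), MvPolynomial.coeff_add,
      hf, hg, Finsupp.filter_add, Finsupp.mapDomain_add, Finsupp.add_apply]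
  | single e n =>
    by_cases h : Q.lab e = a <;> by_cases h1 : Q.tgt e = b <;> by_cases h2 : Q.src e = b <;>
      simp [h, h1, h2, MvPolynomial.coeff_X, Finsupp.filter_single_of_pos,
        Finsupp.filter_single_of_neg, Finsupp.single_left_inj, -zsmul_eq_mul]

open Classical in
theorem coeff_linPoly_true (c₀ : Q.Vert →₀ ℤ) (c : Q.Arr →₀ ℤ) (b : Q.Vert) (a : A) :
    (linPoly c₀ c b).coeff (Finsupp.single (a, true) 1) =
      (c.filter (fun e => Q.lab e = a)).mapDomain Q.src b := by
  have h0 : (0 : A × Bool →₀ ℕ) ≠ Finsupp.single (a, true) 1 :=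
    (Finsupp.single_ne_zero.2 one_ne_zero).symm
  rw [linPoly, MvPolynomial.coeff_add, MvPolynomial.coeff_C, if_neg h0, zero_add]
  induction c using Finsupp.induction_linear with
  | zero => simp [Finsupp.filter_zero]
  | add f g hf hg =>
    rw [Finsupp.sum_add_index' (by simp) (by intros; rw [add_smul]), MvPolynomial.coeff_add,
      hf, hg, Finsupp.filter_add, Finsupp.mapDomain_add, Finsupp.add_apply]
  | single e n =>
    by_cases h : Q.lab e = a <;> by_cases h1 : Q.tgt e = b <;> by_cases h2 : Q.src e = b <;>
      simp [h, h1, h2, MvPolynomial.coeff_X, Finsupp.filter_single_of_pos,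
        Finsupp.filter_single_of_neg, Finsupp.single_left_inj, -zsmul_eq_mul]

theorem coeff_linPoly_add (c₀ : Q.Vert →₀ ℤ) (c : Q.Arr →₀ ℤ) (b : Q.Vert) (p q : A × Bool) :
    (linPoly c₀ c b).coeff (Finsupp.single p 1 + Finsupp.single q 1) = 0 := by
  classical
  have h0 : Finsupp.single p 1 + Finsupp.single q 1 ≠ (0 : A × Bool →₀ ℕ) := fun h => by
    simpa using congrArg Finsupp.degree h
  have h1 (r : A × Bool) : Finsupp.single r 1 ≠ Finsupp.single p 1 + Finsupp.single q 1 :=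
    fun h => by simpa using congrArg Finsupp.degree h
  rw [linPoly, MvPolynomial.coeff_add, MvPolynomial.coeff_C, if_neg h0.symm, zero_add,
    Finsupp.sum, MvPolynomial.coeff_sum]
  refine Finset.sum_eq_zero fun e _ => ?_
  split_ifs <;> simp [MvPolynomial.coeff_X, h1, -zsmul_eq_mul]

-- Arrows with equal label have distinct targets, so no other arrow contributes at this vertex.
open Classical in
theorem filter_mapDomain_tgt_apply (c : Q.Arr →₀ ℤ) (e : Q.Arr) :
    (c.filter (fun e' => Q.lab e' = Q.lab e)).mapDomain Q.tgt (Q.tgt e) = c e := by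
  rw [Finsupp.mapDomain_apply' {e' | Q.lab e' = Q.lab e} _ ?_ ?_ (by simp)]
  · simp
  · intro e' he'
    simp only [Finsupp.support_filter, Finset.coe_filter, Set.mem_ofPred_eq] at he'
    exact he'.2
  · intro e₁ h₁ e₂ h₂ h
    exact Q.tgt_injOn _ _ (Eq.trans h₁ (Eq.symm h₂)) h

/-- The graph of the action of a homomorphism: its values at the endpoints of an arrow are the
pushforwards of one and the same integral combination of arrows with the same label. -/
theorem exists_eq_mapDomain (hv : AlgebraicIndependent ℤ v) (φ : Q.hull v →+ Q'.hull v)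
    (e : Q.Arr) :
    ∃ r : Q'.Arr →₀ ℤ, (∀ e' ∈ r.support, Q'.lab e' = Q.lab e) ∧
      (∀ b, (φ (vert v (Q.tgt e))).1 b = (r.mapDomain Q'.tgt b : ℤ)) ∧
      ∀ b, (φ (vert v (Q.src e))).1 b = (r.mapDomain Q'.src b : ℤ) := by
  classical
  obtain ⟨n₁, h₁⟩ := exists_linPoly_hull (φ (vert v (Q.tgt e)))
  obtain ⟨n₂, h₂⟩ := exists_linPoly_hull (φ (vert v (Q.src e)))
  obtain ⟨n₃, h₃⟩ := exists_linPoly_hull (φ (arr v e))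
  set n := max n₁ (max n₂ n₃)
  obtain ⟨p₀, p, hp⟩ := h₁ n (by simp [n])
  obtain ⟨q₀, q, hq⟩ := h₂ n (by simp [n])
  obtain ⟨l₀, l, hl⟩ := h₃ n (by simp [n])
  set a := Q.lab e
  have hpoly (b : Q'.Vert) : MvPolynomial.X (a, false) * linPoly p₀ p b +
      MvPolynomial.X (a, true) * linPoly q₀ q b = linPoly l₀ l b := by
    apply algebraicIndependent_iff_injective_aeval.1 hv
    rw [map_add, map_mul, map_mul, MvPolynomial.aeval_X, MvPolynomial.aeval_X, ← hp, ← hq, ← hl,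
      map_arr]
    ring
  have hne (i j : A × Bool) (k : A × Bool) : (Finsupp.single k 1 : A × Bool →₀ ℕ) ≠
      Finsupp.single i 1 + Finsupp.single j 1 := fun h => by
    simpa using congrArg Finsupp.degree h
  -- Quadratic coefficients: the second summand of `hpoly` has only monomials divisible by the
  -- variable `(a, true)`, and the right side has degree at most one.
  have hp0 : p = 0 := by
    ext e'
    rw [← filter_mapDomain_tgt_apply, ← coeff_linPoly_false p₀]
    have h := congrArg (MvPolynomial.coeff
      (Finsupp.single (a, false) 1 + Finsupp.single (Q'.lab e', false) 1)) (hpoly (Q'.tgt e'))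
    rw [MvPolynomial.coeff_add, MvPolynomial.coeff_X_mul, coeff_linPoly_add,
      MvPolynomial.coeff_X_mul', if_neg, add_zero] at h
    · exact h
    · simp
  have hC (c₀ : Q'.Vert →₀ ℤ) (b : Q'.Vert) : linPoly c₀ 0 b = MvPolynomial.C (c₀ b) := by
    simp [linPoly]
  -- Now that `p` vanishes, the first summand has no quadratic terms.
  have hq0 : q = 0 := by
    ext e'
    rw [← filter_mapDomain_tgt_apply, ← coeff_linPoly_false q₀]
    have h := congrArg (MvPolynomial.coeff
      (Finsupp.single (a, true) 1 + Finsupp.single (Q'.lab e', false) 1)) (hpoly (Q'.tgt e'))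
    rw [MvPolynomial.coeff_add, MvPolynomial.coeff_X_mul, coeff_linPoly_add, hp0, hC,
      mul_comm (MvPolynomial.X _), MvPolynomial.coeff_C_mul, MvPolynomial.coeff_X, if_neg (hne _ _ _), mul_zero, zero_add] at h
    exact h
  have h1 (b : Q'.Vert) : p₀ b = (l.filter (fun e' => Q'.lab e' = a)).mapDomain Q'.tgt b := by
    have h := congrArg (MvPolynomial.coeff (Finsupp.single (a, false) 1)) (hpoly b)
    rw [coeff_linPoly_false, hp0, hq0, hC, hC] at h
    simp only [← h, MvPolynomial.coeff_add, mul_comm (MvPolynomial.X _), MvPolynomial.coeff_C_mul,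
      MvPolynomial.coeff_X]
    simp [Finsupp.single_left_inj]
  have h2 (b : Q'.Vert) : q₀ b = (l.filter (fun e' => Q'.lab e' = a)).mapDomain Q'.src b := by
    have h := congrArg (MvPolynomial.coeff (Finsupp.single (a, true) 1)) (hpoly b)
    rw [coeff_linPoly_true, hp0, hq0, hC, hC] at h
    simp only [← h, MvPolynomial.coeff_add, mul_comm (MvPolynomial.X _), MvPolynomial.coeff_C_mul,
      MvPolynomial.coeff_X]
    simp [Finsupp.single_left_inj]
  simp only [hp0, hq0, hC, eq_intCast, map_intCast] at hp hq
  -- The integer `l e'` equals `p₀` at the target of `e'`, which is 2 ^ n times a dyadic integer.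
  have hdvd (e' : Q'.Arr) (he' : Q'.lab e' = a) : (2 ^ n : ℤ) ∣ l e' := by
    have h3 := filter_mapDomain_tgt_apply l e'
    rw [he', ← h1] at h3
    have h4 := PadicInt.pow_p_dvd_int_iff (p := 2) n (l e')
    push_cast at h4
    rw [← h4, ← h3, ← hp]
    exact dvd_mul_right _ _
  let r : Q'.Arr →₀ ℤ := (l.filter (fun e' => Q'.lab e' = a)).mapRange (· / 2 ^ n) (by simp)
  have hr : l.filter (fun e' => Q'.lab e' = a) = (2 ^ n : ℤ) • r := by
    ext e'
    by_cases he' : Q'.lab e' = a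
    · simp [r, he', Int.mul_ediv_cancel' (hdvd e' he')]
    · simp [r, he']
  refine ⟨r, fun e' he' => ?_, fun b => ?_, fun b => ?_⟩
  · by_contra hcon
    simp [r, hcon] at he'
  · have h3 := hp b
    rw [h1, hr, Finsupp.mapDomain_smul, Finsupp.smul_apply, smul_eq_mul] at h3
    push_cast at h3
    exact mul_left_cancel₀ (pow_ne_zero n two_ne_zero) h3
  · have h3 := hq b
    rw [h2, hr, Finsupp.mapDomain_smul, Finsupp.smul_apply, smul_eq_mul] at h3
    push_cast at h3
    exact mul_left_cancel₀ (pow_ne_zero n two_ne_zero) h3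

end LabelledQuiver

/-! ### Supports of pushforwards -/

theorem Finsupp.card_support_mapDomain_le {α β : Type*} (f : α → β) (x : α →₀ ℤ) :
    (x.mapDomain f).support.card ≤ x.support.card := by
  classical
  exact (Finset.card_le_card Finsupp.mapDomain_support).trans Finset.card_image_le

/-- A pushforward that does not make the support smaller is a bijection of supports. -/
theorem Finsupp.exists_section_of_card_support_le {α β : Type*} (f : α → β) (x : α →₀ ℤ)
    (y : β →₀ ℤ) (hy : y = x.mapDomain f) (hc : x.support.card ≤ y.support.card) :
    (∀ a ∈ x.support, f a ∈ y.support) ∧ ∃ l : y.support → α, (∀ g : y.support, f (l g) = g) ∧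
      (∀ g, l g ∈ x.support) ∧ (∀ a ∈ x.support, ∀ g : y.support, f a = g → a = l g) ∧
      x = ∑ g ∈ y.support.attach, Finsupp.single (l g) (y g) := by
  classical
  subst hy
  have hsub := Finsupp.mapDomain_support (f := f) (s := x)
  have him : (x.mapDomain f).support = x.support.image f :=
    Finset.eq_of_subset_of_card_le hsub (Finset.card_image_le.trans hc)
  have hinj : Set.InjOn f x.support := Finset.injOn_of_card_image_eq
    (le_antisymm Finset.card_image_le (hc.trans (Finset.card_le_card hsub)))
  have hex (g : (x.mapDomain f).support) : ∃ a ∈ x.support, f a = g :=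
    Finset.mem_image.1 (him ▸ g.2)
  choose l hl hfl using hex
  have huniq : ∀ a ∈ x.support, ∀ g : (x.mapDomain f).support, f a = g → a = l g := fun a ha g hg =>
    hinj ha (hl g) (hg.trans (hfl g).symm)
  refine ⟨fun a ha => him ▸ Finset.mem_image_of_mem f ha, l, hfl, hl, huniq, ?_⟩
  have hval (g : (x.mapDomain f).support) : x.mapDomain f g = x (l g) := by
    rw [← hfl g]
    exact Finsupp.mapDomain_apply' _ x subset_rfl hinj (hl g)
  simp only [hval]
  conv_lhs => rw [← Finsupp.sum_single x]
  refine (Finset.sum_bij (fun g _ => l g) (fun g _ => hl g) ?_ ?_ (fun _ _ => rfl)).symm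
  · intro g _ g' _ h
    exact Subtype.ext (by rw [← hfl g, ← hfl g', h])
  · intro a ha
    exact ⟨⟨f a, him ▸ Finset.mem_image_of_mem f ha⟩, Finset.mem_attach _ _,
      (huniq a ha _ rfl).symm⟩

/-! ### Natural families over countable graphs -/

namespace RelGraph

/-- The relation induced on a set of vertices. -/
def res (X : RelGraph.{u}) (T : Set X.Vertex) : T → T → Prop := fun x y => X.Edge x y

/-- The inclusion of an induced subgraph. -/
def incl (X : RelGraph.{u}) (T : Set X.Vertex) : X.res T →r X.Edge := ⟨Subtype.val, id⟩

/-- The inclusion between two induced subgraphs. -/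
def inclusion (X : RelGraph.{u}) {T U : Set X.Vertex} (h : T ⊆ U) : X.res T →r X.res U :=
  ⟨Set.inclusion h, id⟩

variable {X Y : RelGraph.{u}}

theorem exists_retraction_of_countable {T : Set X.Vertex} (hT : T.Countable) :
    ∃ (C : NatGraph) (f : C.2 →r X.res T) (k : X.res T →r C.2),
      f.comp k = RelHom.id (X.res T) := by
  obtain ⟨e, he⟩ := hT.exists_injective_nat
  let E := Equiv.ofInjective e he
  refine ⟨⟨Set.range e, fun a b => X.res T (E.symm a) (E.symm b)⟩, ⟨E.symm, id⟩, ⟨E, ?_⟩, ?_⟩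
  · intro a b h
    simpa using h
  · ext x
    exact congrArg Subtype.val (E.symm_apply_apply x)

/-- A family natural over the graphs on sets of natural numbers extends to all countable
induced subgraphs. -/
theorem exists_countable_extension
    (Φ : ∀ C : NatGraph, (C.2 →r X.Edge) → ((C.2 →r Y.Edge) →₀ ℤ))
    (hΦ : ∀ (C D : NatGraph) (a : C.2 →r D.2) (h : D.2 →r X.Edge),
      Φ C (h.comp a) = (Φ D h).mapDomain (fun g => g.comp a)) :
    ∃ Ψ : ∀ T : Set X.Vertex, T.Countable → ((X.res T →r Y.Edge) →₀ ℤ),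
      (∀ T hT (C : NatGraph) (h : C.2 →r X.res T),
        Φ C ((X.incl T).comp h) = (Ψ T hT).mapDomain (fun g => g.comp h)) ∧
      ∀ T hT U hU (h : T ⊆ U), Ψ T hT = (Ψ U hU).mapDomain (fun g => g.comp (X.inclusion h)) := by
  choose C f k hfk using fun (T : Set X.Vertex) (hT : T.Countable) =>
    exists_retraction_of_countable hT
  let Ψ (T : Set X.Vertex) (hT : T.Countable) : (X.res T →r Y.Edge) →₀ ℤ :=
    (Φ (C T hT) ((X.incl T).comp (f T hT))).mapDomain (fun g => g.comp (k T hT))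
  have h1 : ∀ T hT (C : NatGraph) (h : C.2 →r X.res T),
      Φ C ((X.incl T).comp h) = (Ψ T hT).mapDomain (fun g => g.comp h) := by
    intro T hT D h
    have h2 := hΦ D (C T hT) ((k T hT).comp h) ((X.incl T).comp (f T hT))
    have h3 : ((X.incl T).comp (f T hT)).comp ((k T hT).comp h) = (X.incl T).comp h :=
      congrArg (fun r => (X.incl T).comp (RelHom.comp r h)) (hfk T hT)
    rw [h3] at h2
    rw [h2, ← Finsupp.mapDomain_comp]
    rfl
  refine ⟨Ψ, h1, fun T hT U hU h => ?_⟩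
  have h2 := h1 U hU (C T hT) ((X.inclusion h).comp (f T hT))
  have h3 : (X.incl U).comp ((X.inclusion h).comp (f T hT)) = (X.incl T).comp (f T hT) := rfl
  rw [h3] at h2
  change Finsupp.mapDomain _ (Φ (C T hT) ((X.incl T).comp (f T hT))) = _
  rw [h2, ← Finsupp.mapDomain_comp]
  congr 1
  funext g
  exact congrArg (fun r => (g.comp (X.inclusion h)).comp r) (hfk T hT)

/-- Were the sizes unbounded, the union of a sequence of witnesses would be a countable set whose
finite support is at least as large as all of theirs. -/
theorem exists_max_card_support
    (Ψ : ∀ T : Set X.Vertex, T.Countable → ((X.res T →r Y.Edge) →₀ ℤ))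
    (hΨ : ∀ T hT U hU (h : T ⊆ U),
      Ψ T hT = (Ψ U hU).mapDomain (fun g => g.comp (X.inclusion h))) :
    ∃ T hT, ∀ U hU, (Ψ U hU).support.card ≤ (Ψ T hT).support.card := by
  let S : Set ℕ := {n | ∃ T hT, n = (Ψ T hT).support.card}
  have hb : BddAbove S := by
    by_contra hcon
    simp only [bddAbove_def, not_exists, not_forall, not_le] at hcon
    choose n hn hlt using hcon
    choose T hT hnT using hn
    have hU : (⋃ i, T i).Countable := Set.countable_iUnion hT
    have h1 := hlt (Ψ _ hU).support.card
    rw [hnT, hΨ _ (hT _) _ hU (Set.subset_iUnion T _)] at h1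
    exact absurd h1 (not_lt.2 (Finsupp.card_support_mapDomain_le _ _))
  obtain ⟨T, hT, h⟩ := Nat.sSup_mem (s := S) ⟨_, ∅, Set.countable_empty, rfl⟩ hb
  exact ⟨T, hT, fun U hU => h ▸ le_csSup hb ⟨U, hU, rfl⟩⟩

/-- A natural family over the countable graphs is induced by an integral combination of
morphisms. -/
theorem exists_eq_mapDomain_comp
    (Φ : ∀ C : NatGraph, (C.2 →r X.Edge) → ((C.2 →r Y.Edge) →₀ ℤ))
    (hΦ : ∀ (C D : NatGraph) (a : C.2 →r D.2) (h : D.2 →r X.Edge),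
      Φ C (h.comp a) = (Φ D h).mapDomain (fun g => g.comp a)) :
    ∃ c : (X.Edge →r Y.Edge) →₀ ℤ, ∀ (C : NatGraph) (h : C.2 →r X.Edge),
      Φ C h = c.mapDomain (fun g => g.comp h) := by
  obtain ⟨Ψ, h1, h2⟩ := exists_countable_extension Φ hΦ
  obtain ⟨T₀, hT₀, hmax⟩ := exists_max_card_support Ψ h2
  have hmono : ∀ T hT, T₀ ⊆ T → (Ψ T₀ hT₀).support.card ≤ (Ψ T hT).support.card := by
    intro T hT h
    rw [h2 T₀ hT₀ T hT h]
    exact Finsupp.card_support_mapDomain_le _ _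
  have hsec := fun T hT (h : T₀ ⊆ T) => (Finsupp.exists_section_of_card_support_le _ (Ψ T hT)
    (Ψ T₀ hT₀) (h2 T₀ hT₀ T hT h) (hmax T hT)).2
  choose l hl hmem huniq hsum using hsec
  have hcoh : ∀ T hT (h : T₀ ⊆ T) U hU (h' : T ⊆ U) (g : (Ψ T₀ hT₀).support),
      (l U hU (h.trans h') g).comp (X.inclusion h') = l T hT h g := by
    intro T hT h U hU h' g
    refine huniq T hT h _ ?_ _ ?_
    · exact (Finsupp.exists_section_of_card_support_le _ (Ψ U hU) (Ψ T hT) (h2 T hT U hU h')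
        ((hmax U hU).trans (hmono T hT h))).1 _ (hmem U hU (h.trans h') g)
    · exact hl U hU (h.trans h') g
  -- Adjoining the single vertex `x` to `T₀` suffices: by `hcoh` any larger countable set gives the
  -- same value.
  let φ₀ (g : (Ψ T₀ hT₀).support) (x : X.Vertex) : Y.Vertex :=
    l (insert x T₀) (hT₀.insert x) (Set.subset_insert x T₀) g ⟨x, Set.mem_insert x T₀⟩
  have hφ₀ : ∀ T hT (h : T₀ ⊆ T) g (x : X.Vertex) (hx : x ∈ T), l T hT h g ⟨x, hx⟩ = φ₀ g x := by
    intro T hT h g x hx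
    have := hcoh (insert x T₀) (hT₀.insert x) (Set.subset_insert x T₀) T hT
      (Set.insert_subset hx h) g
    exact DFunLike.congr_fun this ⟨x, Set.mem_insert x T₀⟩
  let φ (g : (Ψ T₀ hT₀).support) : X.Edge →r Y.Edge := ⟨φ₀ g, by
    intro x y hxy
    -- Both ends of the edge must lie in one induced subgraph.
    have hc : (insert x (insert y T₀)).Countable := (hT₀.insert y).insert x
    have hs : T₀ ⊆ insert x (insert y T₀) :=
      (Set.subset_insert y T₀).trans (Set.subset_insert x _)
    rw [← hφ₀ _ hc hs g x (by simp), ← hφ₀ _ hc hs g y (by simp)]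
    exact (l _ hc hs g).map_rel hxy⟩
  refine ⟨∑ g ∈ (Ψ T₀ hT₀).support.attach, Finsupp.single (φ g) (Ψ T₀ hT₀ g), fun C h => ?_⟩
  have hcount : (T₀ ∪ Set.range h).Countable := hT₀.union (Set.countable_range h)
  let h' : C.2 →r X.res (T₀ ∪ Set.range h) :=
    ⟨fun x => ⟨h x, Or.inr ⟨x, rfl⟩⟩, fun hxy => h.map_rel hxy⟩
  have h3 := h1 _ hcount C h'
  rw [hsum _ hcount Set.subset_union_left, Finsupp.mapDomain_finsetSum] at h3
  rw [Finsupp.mapDomain_finsetSum]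
  refine h3.trans (Finset.sum_congr rfl fun g _ => ?_)
  rw [Finsupp.mapDomain_single, Finsupp.mapDomain_single]
  congr 1
  ext x
  exact hφ₀ _ _ _ g (h x) _

end RelGraph

/-! ### The functor and its homomorphisms -/

namespace RelGraph

open LabelledQuiver

/-- The quiver of all morphisms from graphs on sets of natural numbers to a graph; an arrow joins
a composite `h ∘ a` to `h`, and its label is `a`. -/
def quiver (X : RelGraph.{u}) : LabelledQuiver.{u} NatGraph.Arrow where
  Vert := Σ C : NatGraph, C.2 →r X.Edge
  Arr := Σ a : NatGraph.Arrow, a.1.2.2 →r X.Edge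
  lab e := e.1
  src e := ⟨e.1.1.1, e.2.comp e.1.2⟩
  tgt e := ⟨e.1.1.2, e.2⟩
  tgt_injOn := by
    rintro ⟨a, h⟩ ⟨a', h'⟩ haa' hh
    obtain rfl : a = a' := haa'
    have h1 : h = h' := sigma_mk_injective (β := fun C : NatGraph => C.2 →r X.Edge) hh
    rw [h1]

variable {X Y : RelGraph.{u}} {v : NatGraph.Arrow × Bool → ℤ_[2]}

/-- A morphism from a graph on a set of natural numbers as a vertex of the quiver. -/
def toVert {X : RelGraph.{u}} (C : NatGraph) (h : C.2 →r X.Edge) : X.quiver.Vert := ⟨C, h⟩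

theorem toVert_injective (C : NatGraph) :
    Function.Injective (toVert C : (C.2 →r X.Edge) → X.quiver.Vert) :=
  sigma_mk_injective (β := fun C : NatGraph => C.2 →r X.Edge)

/-- The action of a morphism of graphs on the vertices of the quivers. -/
def vertMap (φ : X.Edge →r Y.Edge) (b : X.quiver.Vert) : Y.quiver.Vert := ⟨b.1, φ.comp b.2⟩

theorem mapDomain_arrVec (φ : X.Edge →r Y.Edge) (e : X.quiver.Arr) :
    (X.quiver.arrVec v e).mapDomain (vertMap φ) = Y.quiver.arrVec v ⟨e.1, φ.comp e.2⟩ := by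
  rw [arrVec, Finsupp.mapDomain_add, Finsupp.mapDomain_single, Finsupp.mapDomain_single]
  rfl

theorem mapDomain_mem_gen (φ : X.Edge →r Y.Edge) {x : X.quiver.Vert →₀ ℤ_[2]}
    (hx : x ∈ X.quiver.gen v) : x.mapDomain (vertMap φ) ∈ Y.quiver.gen v := by
  have h : X.quiver.gen v ≤ (Y.quiver.gen v).comap
      (Finsupp.mapDomain.addMonoidHom (vertMap φ)) := by
    refine (AddSubgroup.closure_le _).2 ?_
    rintro x (⟨b, rfl⟩ | ⟨e, rfl⟩)
    · refine AddSubgroup.subset_closure (Or.inl ⟨vertMap φ b, ?_⟩)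
      exact Finsupp.mapDomain_single.symm
    · exact AddSubgroup.subset_closure (Or.inr ⟨_, (mapDomain_arrVec φ e).symm⟩)
  exact h hx

theorem mapDomain_mem_hull (φ : X.Edge →r Y.Edge) {x : X.quiver.Vert →₀ ℤ_[2]}
    (hx : x ∈ X.quiver.hull v) : x.mapDomain (vertMap φ) ∈ Y.quiver.hull v := by
  obtain ⟨k, hk⟩ := hx
  refine ⟨k, ?_⟩
  rw [← Finsupp.mapDomain_smul]
  exact mapDomain_mem_gen φ hk

/-- The homomorphism of pure hulls induced by a morphism of graphs. -/
noncomputable def hullMap (v : NatGraph.Arrow × Bool → ℤ_[2]) (φ : X.Edge →r Y.Edge) :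
    X.quiver.hull v →+ Y.quiver.hull v :=
  ((Finsupp.mapDomain.addMonoidHom (vertMap φ)).comp (X.quiver.hull v).subtype).codRestrict _
    fun x => mapDomain_mem_hull φ x.2

theorem hullMap_vert (φ : X.Edge →r Y.Edge) (b : X.quiver.Vert) :
    hullMap v φ (vert v b) = vert v (vertMap φ b) :=
  Subtype.ext Finsupp.mapDomain_single

/-- The functor from graphs to abelian groups defined by a family of dyadic integers. -/
noncomputable def hullFunctor (v : NatGraph.Arrow × Bool → ℤ_[2]) :
    RelGraph.{u} ⥤ AddCommGrpCat.{u} where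
  obj X := AddCommGrpCat.of (X.quiver.hull v)
  map φ := AddCommGrpCat.ofHom (hullMap v φ)
  map_id X := by
    refine AddCommGrpCat.hom_ext (hom_ext fun b => ?_)
    exact hullMap_vert _ b
  map_comp {X Y Z} φ ψ := by
    refine AddCommGrpCat.hom_ext (hom_ext fun b => ?_)
    change hullMap v (ψ.comp φ) (vert v b) = hullMap v ψ (hullMap v φ (vert v b))
    rw [hullMap_vert, hullMap_vert, hullMap_vert]
    rfl

/-- The combination of arrows from `exists_eq_mapDomain` has all labels equal to `a`, so it is a
combination of morphisms from `D`. -/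
theorem exists_eq_mapDomain_arrow (hv : AlgebraicIndependent ℤ v)
    (ψ : X.quiver.hull v →+ Y.quiver.hull v) (C D : NatGraph) (a : C.2 →r D.2)
    (h : D.2 →r X.Edge) :
    ∃ s : (D.2 →r Y.Edge) →₀ ℤ,
      (∀ b : Y.quiver.Vert, (ψ (vert v (toVert D h))).1 b =
        (s.mapDomain (toVert D) b : ℤ)) ∧
      ∀ b : Y.quiver.Vert, (ψ (vert v (toVert C (h.comp a)))).1 b =
        (s.mapDomain (fun g => toVert C (g.comp a)) b : ℤ) := by
  let a' : NatGraph.Arrow := ⟨(C, D), a⟩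
  let e : X.quiver.Arr := ⟨a', h⟩
  obtain ⟨r, hr, h1, h2⟩ := exists_eq_mapDomain hv ψ e
  let j : (D.2 →r Y.Edge) → Y.quiver.Arr := fun g => ⟨a', g⟩
  have hj : Function.Injective j := fun _ _ h =>
    sigma_mk_injective (β := fun a : NatGraph.Arrow => a.1.2.2 →r Y.Edge) h
  have hrj : (r.support : Set Y.quiver.Arr) ⊆ Set.range j := by
    rintro ⟨a₁, g⟩ he
    obtain rfl : a₁ = a' := hr _ he
    exact ⟨g, rfl⟩
  have hs := Finsupp.mapDomain_comapDomain j hj r hrj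
  refine ⟨r.comapDomain j hj.injOn, fun b => ?_, fun b => ?_⟩
  · refine (h1 b).trans ?_
    rw [← hs, ← Finsupp.mapDomain_comp]
    simp only [hs]
    rfl
  · refine (h2 b).trans ?_
    rw [← hs, ← Finsupp.mapDomain_comp]
    simp only [hs]
    rfl

theorem exists_natural_family (hv : AlgebraicIndependent ℤ v)
    (ψ : X.quiver.hull v →+ Y.quiver.hull v) :
    ∃ Φ : ∀ C : NatGraph, (C.2 →r X.Edge) → ((C.2 →r Y.Edge) →₀ ℤ),
      (∀ (C : NatGraph) (h : C.2 →r X.Edge) (b : Y.quiver.Vert), (ψ (vert v (toVert C h))).1 b =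
        ((Φ C h).mapDomain (toVert C) b : ℤ)) ∧
      ∀ (C D : NatGraph) (a : C.2 →r D.2) (h : D.2 →r X.Edge),
        Φ C (h.comp a) = (Φ D h).mapDomain (fun g => g.comp a) := by
  -- Every vertex is the target of an identity arrow, which already yields integral coefficients on
  -- morphisms from the same graph.
  choose Φ hΦ using fun (C : NatGraph) (h : C.2 →r X.Edge) =>
    exists_eq_mapDomain_arrow hv ψ C C (RelHom.id C.2) h
  refine ⟨Φ, fun C h => (hΦ C h).1, fun C D a h => ?_⟩
  obtain ⟨s, h1, h2⟩ := exists_eq_mapDomain_arrow hv ψ C D a h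
  have hD : Φ D h = s := by
    apply Finsupp.mapDomain_injective (toVert_injective D)
    ext b
    exact Int.cast_injective (((hΦ D h).1 b).symm.trans (h1 b))
  apply Finsupp.mapDomain_injective (toVert_injective C)
  rw [hD, ← Finsupp.mapDomain_comp]
  ext b
  exact Int.cast_injective (((hΦ C _).1 b).symm.trans (h2 b))

/-- The homomorphism of pure hulls induced by an integral combination of morphisms. -/
noncomputable def combMap (v : NatGraph.Arrow × Bool → ℤ_[2]) (X Y : RelGraph.{u}) :
    ((X.Edge →r Y.Edge) →₀ ℤ) →+ (X.quiver.hull v →+ Y.quiver.hull v) :=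
  Finsupp.liftAddHom fun φ => zmultiplesHom _ (hullMap v φ)

theorem combMap_single (φ : X.Edge →r Y.Edge) (n : ℤ) :
    combMap v X Y (Finsupp.single φ n) = n • hullMap v φ :=
  Finsupp.liftAddHom_apply_single _ _ _

theorem combMap_vert (c : (X.Edge →r Y.Edge) →₀ ℤ) (C : NatGraph) (h : C.2 →r X.Edge)
    (b : Y.quiver.Vert) :
    (combMap v X Y c (vert v (toVert C h))).1 b =
      ((c.mapDomain fun φ => toVert C (φ.comp h)) b : ℤ) := by
  classical
  induction c using Finsupp.induction_linear with
  | zero =>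
    rw [map_zero, Finsupp.mapDomain_zero, Finsupp.zero_apply, Int.cast_zero]
    rfl
  | add f g hf hg =>
    rw [map_add, Finsupp.mapDomain_add, AddMonoidHom.add_apply, AddSubgroup.coe_add,
      Finsupp.add_apply, Finsupp.add_apply, hf, hg, Int.cast_add]
  | single φ n =>
    rw [combMap_single, Finsupp.mapDomain_single]
    change (n • (hullMap v φ (vert v (toVert C h))).1) b = _
    rw [hullMap_vert]
    change (n • Finsupp.single (toVert C (φ.comp h)) (1 : ℤ_[2])) b = _
    rw [Finsupp.smul_single, Finsupp.single_apply, Finsupp.single_apply]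
    split_ifs <;> simp

theorem combMap_surjective (hv : AlgebraicIndependent ℤ v) :
    Function.Surjective (combMap v X Y) := by
  intro ψ
  obtain ⟨Φ, h1, h2⟩ := exists_natural_family hv ψ
  obtain ⟨c, hc⟩ := exists_eq_mapDomain_comp Φ h2
  refine ⟨c, hom_ext fun b => Subtype.ext (Finsupp.ext fun b' => ?_)⟩
  obtain ⟨C, h⟩ := b
  refine (combMap_vert c C h b').trans (Eq.symm ((h1 C h b').trans ?_))
  rw [hc, ← Finsupp.mapDomain_comp]
  rfl

/-- One vertex separates each pair of distinct morphisms; the countable set of these vertices is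
then modelled on natural numbers. -/
theorem exists_injOn_comp (s : Finset (X.Edge →r Y.Edge)) :
    ∃ (C : NatGraph) (h : C.2 →r X.Edge), Set.InjOn (fun φ : X.Edge →r Y.Edge => φ.comp h) s := by
  classical
  have hx (p : (X.Edge →r Y.Edge) × (X.Edge →r Y.Edge)) : ∃ T : Set X.Vertex, T.Countable ∧
      ((∀ x ∈ T, p.1 x = p.2 x) → p.1 = p.2) := by
    by_cases hp : p.1 = p.2
    · exact ⟨∅, Set.countable_empty, fun _ => hp⟩
    · obtain ⟨x, hx⟩ := DFunLike.ne_iff.1 hp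
      exact ⟨{x}, Set.countable_singleton x, fun h => absurd (h x rfl) hx⟩
  choose T hT hsep using hx
  have hU : (⋃ p ∈ s ×ˢ s, T p).Countable :=
    Set.Countable.biUnion (Finset.countable_toSet _) fun p _ => hT p
  obtain ⟨C, f, k, hfk⟩ := exists_retraction_of_countable hU
  refine ⟨C, (X.incl _).comp f, fun φ hφ ψ hψ h => hsep (φ, ψ) fun x hx => ?_⟩
  have hxU : x ∈ ⋃ p ∈ s ×ˢ s, T p :=
    Set.mem_biUnion (x := (φ, ψ)) (Finset.mem_product.2 ⟨hφ, hψ⟩) hx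
  have h1 := DFunLike.congr_fun h (k ⟨x, hxU⟩)
  have h2 : f (k ⟨x, hxU⟩) = ⟨x, hxU⟩ := DFunLike.congr_fun hfk ⟨x, hxU⟩
  change φ (f (k ⟨x, hxU⟩)).1 = ψ (f (k ⟨x, hxU⟩)).1 at h1
  rwa [h2] at h1

theorem combMap_injective : Function.Injective (combMap v X Y) := by
  refine (injective_iff_map_eq_zero _).2 fun c hc => ?_
  obtain ⟨C, h, hinj⟩ := exists_injOn_comp c.support
  ext φ
  by_contra hφ
  have h1 := combMap_vert (v := v) c C h (toVert C (φ.comp h))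
  have h2 : (c.mapDomain fun φ => (toVert C (φ.comp h) : Y.quiver.Vert)) (toVert C (φ.comp h)) =
      c φ := Finsupp.mapDomain_apply' (f := fun φ => (toVert C (φ.comp h) : Y.quiver.Vert))
    (c.support : Set (X.Edge →r Y.Edge)) c subset_rfl
    (fun _ h₁ _ h₂ h₃ => hinj h₁ h₂ (toVert_injective C h₃)) (Finsupp.mem_support_iff.2 hφ)
  rw [hc, h2] at h1
  exact hφ (Int.cast_injective (α := ℤ_[2]) (h1.symm.trans (by simp)))

/-- The additive extension of the functor to integral combinations of morphisms. -/
noncomputable def liftMap (v : NatGraph.Arrow × Bool → ℤ_[2]) (X Y : RelGraph.{u}) :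
    FreeAbelianGroup (X ⟶ Y) →+ ((hullFunctor v).obj X ⟶ (hullFunctor v).obj Y) :=
  AddCommGrpCat.homAddEquiv.symm.toAddMonoidHom.comp
    ((combMap v X Y).comp (FreeAbelianGroup.equivFinsupp (X ⟶ Y)).toAddMonoidHom)

theorem liftMap_of (φ : X ⟶ Y) :
    liftMap v X Y (FreeAbelianGroup.of φ) = (hullFunctor v).map φ := by
  refine AddCommGrpCat.hom_ext ?_
  change combMap v X Y (FreeAbelianGroup.toFinsupp (FreeAbelianGroup.of φ)) = hullMap v φ
  rw [FreeAbelianGroup.toFinsupp_of]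
  exact (combMap_single φ 1).trans (AddMonoidHom.ext fun x => one_zsmul _)

theorem liftMap_bijective (hv : AlgebraicIndependent ℤ v) :
    Function.Bijective (liftMap v X Y) :=
  AddCommGrpCat.homAddEquiv.symm.bijective.comp
    (Function.Bijective.comp (g := combMap v X Y) ⟨combMap_injective, combMap_surjective hv⟩
      (FreeAbelianGroup.equivFinsupp _).bijective)

theorem liftMap_natural {X' Y' : RelGraph.{u}} (f : X' ⟶ X) (g : Y ⟶ Y')
    (a : FreeAbelianGroup (X ⟶ Y)) :
    liftMap v X' Y' (FreeAbelianGroup.map (fun φ : X ⟶ Y => f ≫ φ ≫ g) a) =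
      (hullFunctor v).map f ≫ liftMap v X Y a ≫ (hullFunctor v).map g := by
  induction a using FreeAbelianGroup.induction_on with
  | zero => simp
  | of φ => rw [FreeAbelianGroup.map_of_apply, liftMap_of, liftMap_of, Functor.map_comp,
      Functor.map_comp]
  | neg φ h => rw [map_neg, map_neg, h, map_neg, Preadditive.neg_comp, Preadditive.comp_neg]
  | add x y hx hy =>
    rw [map_add, map_add, hx, hy, map_add, Preadditive.add_comp, Preadditive.comp_add]

end RelGraph

theorem corollary3p13 :
    ∃ G : RelGraph.{u} ⥤ AddCommGrpCat.{u},
      (∀ X : RelGraph.{u}, IsAddTorsionFree (G.obj X)) ∧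
      ∃ γ : ∀ X Y : RelGraph.{u}, FreeAbelianGroup (X ⟶ Y) ≃+ (G.obj X ⟶ G.obj Y),
        (∀ (X Y : RelGraph.{u}) (φ : X ⟶ Y), γ X Y (FreeAbelianGroup.of φ) = G.map φ) ∧
        (∀ (X X' Y Y' : RelGraph.{u}) (f : X' ⟶ X) (g : Y ⟶ Y') (a : FreeAbelianGroup (X ⟶ Y)),
          γ X' Y' (FreeAbelianGroup.map (fun φ : X ⟶ Y => f ≫ φ ≫ g) a) =
            G.map f ≫ γ X Y a ≫ G.map g) := by
  obtain ⟨v, hv⟩ := exists_algebraicIndependent_padicInt _ NatGraph.mk_arrow_prod_bool_le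
  refine ⟨RelGraph.hullFunctor v, fun X => ?_, fun X Y => AddEquiv.ofBijective
    (RelGraph.liftMap v X Y) (RelGraph.liftMap_bijective hv), fun X Y φ => ?_, ?_⟩
  · change IsAddTorsionFree (X.quiver.hull v)
    infer_instance
  · exact RelGraph.liftMap_of φ
  · intro X X' Y Y' f g a
    exact RelGraph.liftMap_natural f g a
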